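/- Let $\mathbb{K}$ be an algebraically closed field, let $\underline{t}=(t_1,t_2,t_3)$ and $\underline{X}=(X_1,X_2,X_3,X_4)$ be variables, and let $d>2$. Let $u_1,u_2,u_3,u_4\in\mathbb{K}[\underline{t}]$ be nonzero homogeneous polynomials of degree $d$ with $\gcd(u_1,u_2,u_3,u_4)=1$, such that the ideal $\mathcal{I}=\langle u_1,u_2,u_3,u_4\rangle$ is saturated with respect to $\langle t_1,t_2,t_3\rangle$. Suppose that the syzygy module $\mathrm{Syz}(\mathcal{I})=\{(a_1,\dots,a_4)\in\mathbb{K}[\underline{t}]^4:\ \sum_j a_ju_j=0\}$ has a $\mathbb{K}[\underline{t}]$-basis $\{a^{(1)},a^{(2)},a^{(3)}\}$ whose members have homogeneous entries of degrees $\mu_1=1$, $\mu_2=1$ and $\mu_3=d-2$ respectively, and put $p_i(\underline{t},\underline{X})=\sum_{j=1}^4 a^{(i)}_j(\underline{t})X_j\in\mathbb{K}[\underline{t},\underline{X}]$. Let $\mathrm{S}\subset\mathbb{P}^3$ be the Zariski closure of the image of the rational map $\mathbb{P}^2\dashrightarrow\mathbb{P}^3$, $\underline{t}\mapsto(u_1(\underline{t}):u_2(\underline{t}):u_3(\underline{t}):u_4(\underline{t}))$.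 If $\mathrm{S}$ is a surface of degree $\deg(\mathrm{S})\geq 3$ (the degree of its implicit equation, i.e. of the generator of its homogeneous ideal), then the ideal $\mathcal{N}=\langle p_1,p_2\rangle\subset\mathbb{K}[\underline{t},\underline{X}]$ is prime. -/

import Mathlib

noncomputable section

namespace MovingPlanes

open MvPolynomial
open scoped LinearAlgebra.Projectivization

variable {K : Type*} [Field K]

/-- The syzygy module of the sequence `u`: all `a` with `∑ i, a i * u i = 0`. -/
def syz {m n : ℕ} (u : Fin m → MvPolynomial (Fin n) K) :
    Submodule (MvPolynomial (Fin n) K) (Fin m → MvPolynomial (Fin n) K) :=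
  LinearMap.ker (Fintype.linearCombination (MvPolynomial (Fin n) K) u)

/-- The polynomial `∑ j, a_j(t) X_j` of `K[t, X]` attached to `a`; the variables `t` are indexed by
the left summand and the variables `X` by the right one. -/
def movingPlane {m n : ℕ} (a : Fin m → MvPolynomial (Fin n) K) :
    MvPolynomial (Fin n ⊕ Fin m) K :=
  ∑ j, rename Sum.inl (a j) * X (Sum.inr j)

/-- The ideal is saturated with respect to the ideal `𝔪` generated by the variables:
`I : 𝔪 ^ ∞ = I`. -/
def IsSaturated {n : ℕ} (I : Ideal (MvPolynomial (Fin n) K)) : Prop :=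
  ∀ f : MvPolynomial (Fin n) K,
    (∃ k : ℕ, ∀ g ∈ (Ideal.span (Set.range (X : Fin n → MvPolynomial (Fin n) K))) ^ k,
      g * f ∈ I) → f ∈ I

/-- The affine cone, without its vertex, over a set of points of projective space. -/
def affineCone {m : ℕ} (Z : Set (ℙ K (Fin m → K))) : Set (Fin m → K) :=
  {v | ∃ hv : v ≠ 0, Projectivization.mk K v hv ∈ Z}

/-- The Zariski closure of a set of points of projective space: the common zeros of all
homogeneous polynomials that vanish on it. -/
def zariskiClosure {m : ℕ} (Z : Set (ℙ K (Fin m → K))) : Set (ℙ K (Fin m → K)) :=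
  {P | ∀ (k : ℕ) (f : MvPolynomial (Fin m) K), f.IsHomogeneous k →
    (∀ v ∈ affineCone Z, eval v f = 0) → ∀ v ∈ affineCone {P}, eval v f = 0}

/-- The image of the rational map `t ↦ (u_1(t) : ... : u_m(t))`, which is defined at the points
where the `u_i` do not all vanish. -/
def ratImage {m n : ℕ} (u : Fin m → MvPolynomial (Fin n) K) : Set (ℙ K (Fin m → K)) :=
  {P | ∃ t : Fin n → K, t ≠ 0 ∧ ∃ h : (fun i => eval t (u i)) ≠ 0,
    P = Projectivization.mk K (fun i => eval t (u i)) h}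

/-- The variety parametrized by `u`. -/
def paramVariety {m n : ℕ} (u : Fin m → MvPolynomial (Fin n) K) : Set (ℙ K (Fin m → K)) :=
  zariskiClosure (ratImage u)

/-- `S` is a hypersurface of degree `δ`: its ideal is generated by one non-constant polynomial
(its implicit equation), and `δ` is the degree of this polynomial. -/
def IsHypersurfaceOfDegree {m : ℕ} (S : Set (ℙ K (Fin m → K))) (δ : ℕ) : Prop :=
  ∃ E : MvPolynomial (Fin m) K, E ≠ 0 ∧ ¬ IsUnit E ∧
    vanishingIdeal K (affineCone S) = Ideal.span {E} ∧ E.totalDegree = δ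

end MovingPlanes

end

/-!
Let `p` and `q` be the moving planes of the two syzygies `a` and `c` of degree one, read as linear
forms in `X` over `K[t]`, and let `τ = a i` be a nonzero entry of `a`. Once `τ` is inverted, `p`
eliminates `X i` and turns `q` into a linear form whose content divides the `2 × 2` minors of the
matrix with rows `a` and `c`. These minors have no common factor because `a` and `c` belong to a
basis of the syzygy module, so `(p, q)` becomes prime. It remains to see that `τ` is regular modulo
`(p, q)`, that is, that `p` and `q` stay coprime on the hyperplane `τ = 0`. A common factor on this
hyperplane is a form `s` in `t`, which puts all entries of `a` and `c` into the span of `s` and `τ`.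
The coefficients with respect to `s` and `τ` make up a `2 × 2` matrix of linear forms in `X` whose
determinant vanishes on the parametrized surface. As the degree of the surface is at least three,
this determinant is zero, and then the minors would be zero or have a common factor.
-/

noncomputable section

namespace MovingPlanes

open MvPolynomial

/-- A reduction modulo `x`: a ring endomorphism that kills `x` and moves no element out of its class
modulo `x`. It serves as a model of the quotient map `A → A ⧸ (x)` with values in `A` itself. -/
structure IsReductionMod {A : Type*} [CommRing A] (π : A →+* A) (x : A) : Prop where
  map_self : π x = 0
  dvd_sub_map : ∀ f, x ∣ f - π f

namespace IsReductionMod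

variable {A : Type*} [CommRing A] {π : A →+* A} {x : A}

lemma dvd_of_map_eq_zero (hπ : IsReductionMod π x) {f : A} (hf : π f = 0) : x ∣ f := by
  simpa only [hf, sub_zero] using hπ.dvd_sub_map f

lemma span_pair_eq_comap (hπ : IsReductionMod π x) (y : A) :
    Ideal.span {x, y} = (Ideal.span {π y}).comap π := by
  refine le_antisymm (Ideal.span_le.2 ?_) fun f hf => ?_
  · rintro _ (rfl | rfl)
    · simp [hπ.map_self]
    · exact Ideal.mem_span_singleton_self _
  · obtain ⟨g, hg⟩ := Ideal.mem_span_singleton.1 hf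
    obtain ⟨v, hv⟩ := hπ.dvd_sub_map f
    obtain ⟨w, hw⟩ := hπ.dvd_sub_map y
    exact Ideal.mem_span_pair.2 ⟨v - g * w, g, by linear_combination -hv + g * hw - hg⟩

lemma isPrime_span_pair [IsDomain A] (hπ : IsReductionMod π x) {y : A} (hy : Prime (π y)) :
    (Ideal.span {x, y}).IsPrime := by
  have := (Ideal.span_singleton_prime hy.ne_zero).2 hy
  rw [hπ.span_pair_eq_comap]
  exact Ideal.comap_isPrime π _

/-- The regular sequence `x, p, q` may be reordered to `p, q, x`. -/
lemma mem_span_pair_of_mul_mem [IsDomain A] [DecompositionMonoid A] (hπ : IsReductionMod π x)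
    (hx : x ≠ 0) {p q : A} (hpq : IsRelPrime (π p) (π q)) (hp : π p ≠ 0) {f : A}
    (hf : x * f ∈ Ideal.span {p, q}) : f ∈ Ideal.span {p, q} := by
  obtain ⟨α, β, hαβ⟩ := Ideal.mem_span_pair.1 hf
  have hsyz : π α * π p + π β * π q = 0 := by
    rw [← map_mul, ← map_mul, ← map_add, hαβ, map_mul, hπ.map_self, zero_mul]
  obtain ⟨γ, hβ⟩ : π p ∣ π β :=
    hpq.dvd_of_dvd_mul_right ⟨-π α, by linear_combination hsyz⟩
  have hα : π α = -(γ * π q) :=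
    mul_left_cancel₀ hp (by linear_combination hsyz - π q * hβ)
  -- Subtracting a multiple of the syzygy `(-q, p)` makes both coefficients multiples of `x`.
  obtain ⟨α', hα'⟩ : x ∣ α + γ * q := by
    convert dvd_add (hπ.dvd_sub_map α) ((hπ.dvd_sub_map q).mul_left γ) using 1
    linear_combination hα
  obtain ⟨β', hβ'⟩ : x ∣ β - γ * p := by
    convert dvd_sub (hπ.dvd_sub_map β) ((hπ.dvd_sub_map p).mul_left γ) using 1
    linear_combination hβ
  refine Ideal.mem_span_pair.2 ⟨α', β', mul_left_cancel₀ hx ?_⟩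
  linear_combination hαβ - p * hα' - q * hβ'

lemma mvPolynomial_map (hπ : IsReductionMod π x) (ι : Type*) :
    IsReductionMod (map π : MvPolynomial ι A →+* MvPolynomial ι A) (C x) where
  map_self := by rw [map_C, hπ.map_self, C_0]
  dvd_sub_map f := (C_dvd_iff_dvd_coeff _ _).2 fun m => by
    rw [coeff_sub, coeff_map]
    exact hπ.dvd_sub_map _

end IsReductionMod

/-- A family of elements whose only common divisors are the units. -/
def IsPrimitiveFamily {R κ : Type*} [CommRing R] (f : κ → R) : Prop :=
  ∀ r, (∀ k, r ∣ f k) → IsUnit r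

lemma IsPrimitiveFamily.ne_zero {R κ : Type*} [CommRing R] [Nontrivial R] {f : κ → R}
    (hf : IsPrimitiveFamily f) : f ≠ 0 := by
  rintro rfl
  exact not_isUnit_zero (hf 0 fun _ => dvd_rfl)

lemma isPrimitiveFamily_of_ne_zero {K κ : Type*} [Field K] {f : κ → K} (hf : f ≠ 0) :
    IsPrimitiveFamily f := by
  refine fun r hr => Ne.isUnit ?_
  rintro rfl
  exact hf (funext fun k => zero_dvd_iff.1 (hr k))

lemma IsPrimitiveFamily.of_isLocalization {R κ : Type*} [CommRing R] [IsDomain R]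
    [UniqueFactorizationMonoid R] (M : Submonoid R) (S : Type*) [CommRing S] [Algebra R S]
    [IsLocalization M S] {f : κ → R} (hf : IsPrimitiveFamily f) :
    IsPrimitiveFamily fun k => algebraMap R S (f k) := by
  have of_prime_or_zero (r : R) (hr : ∀ x y, r ∣ x * y → r ∣ x ∨ r ∣ y)
      (hrf : ∀ k, algebraMap R S r ∣ algebraMap R S (f k)) : IsUnit (algebraMap R S r) := by
    by_contra hru
    have not_dvd : ∀ m ∈ M, ¬ r ∣ m := fun m hm h =>
      hru (isUnit_of_dvd_unit (map_dvd _ h) (IsLocalization.map_units S ⟨m, hm⟩))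
    refine hru ((hf r fun k => ?_).map _)
    obtain ⟨m, hm, hmf⟩ := (IsLocalization.toLocalizationMap M S).map_dvd_map.1 (hrf k)
    exact (hr m _ hmf).resolve_left (not_dvd m hm)
  have of_mem_range (r : R) (hrf : ∀ k, algebraMap R S r ∣ algebraMap R S (f k)) :
      IsUnit (algebraMap R S r) := by
    induction r using UniqueFactorizationMonoid.induction_on_prime with
    | h₁ => exact of_prime_or_zero 0 (by simp) hrf
    | h₂ r hr => exact hr.map _
    | h₃ r p _ hp ih =>
      rw [map_mul] at hrf ⊢
      exact (of_prime_or_zero p (fun _ _ => hp.dvd_or_dvd)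
        fun k => dvd_of_mul_right_dvd (hrf k)).mul (ih fun k => dvd_of_mul_left_dvd (hrf k))
  intro r hr
  obtain ⟨⟨x, m⟩, hx⟩ := IsLocalization.surj M r
  have hm := IsLocalization.map_units S m
  refine isUnit_of_mul_isUnit_left (y := algebraMap R S m) ?_
  rw [hx]
  refine of_mem_range x fun k => ?_
  rw [← hx, hm.mul_right_dvd]
  exact hr k

/-- The family of the `2 × 2` minors of the matrix with rows `a` and `c`. -/
def minor {R ι : Type*} [CommRing R] (a c : ι → R) (p : ι × ι) : R :=
  a p.1 * c p.2 - a p.2 * c p.1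

section Minor

variable {R ι : Type*} [CommRing R] {a c : ι → R}

lemma left_ne_zero_of_minor_ne_zero (h : minor a c ≠ 0) : a ≠ 0 := by
  rintro rfl
  exact h (by ext; simp [minor])

lemma right_ne_zero_of_minor_ne_zero (h : minor a c ≠ 0) : c ≠ 0 := by
  rintro rfl
  exact h (by ext; simp [minor])

lemma map_minor {S : Type*} [CommRing S] (φ : R →+* S) (a c : ι → R) (p : ι × ι) :
    φ (minor a c p) = minor (φ ∘ a) (φ ∘ c) p := by
  simp only [minor, map_sub, map_mul, Function.comp_apply]

lemma minor_sub_smul_right (a c : ι → R) (k : R) : minor a (c - k • a) = minor a c := by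
  ext p
  simp only [minor, Pi.sub_apply, Pi.smul_apply, smul_eq_mul]
  ring

lemma dvd_minor {r : R} (ha : ∀ j, r ∣ a j) (p : ι × ι) : r ∣ minor a c p :=
  dvd_sub ((ha _).mul_right _) ((ha _).mul_right _)

end Minor

lemma not_isUnit_of_isHomogeneous {R σ : Type*} [CommRing R] [Nontrivial R]
    {f : MvPolynomial σ R} {n : ℕ} (hf : f.IsHomogeneous n) (hn : n ≠ 0) : ¬ IsUnit f := by
  intro hu
  have h0 : constantCoeff f = 0 := hf.coeff_eq_zero (by simpa using hn.symm)
  exact not_isUnit_zero (h0 ▸ hu.map constantCoeff)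

lemma exists_eq_C_of_isHomogeneous_mul {R σ : Type*} [CommRing R] [IsDomain R]
    {f g : MvPolynomial σ R} (h : (f * g).IsHomogeneous 1) (h0 : f * g ≠ 0) :
    (∃ r, f = C r) ∨ ∃ r, g = C r := by
  have hdeg : f.totalDegree + g.totalDegree = 1 := by
    rw [← totalDegree_mul_of_isDomain (left_ne_zero_of_mul h0) (right_ne_zero_of_mul h0),
      h.totalDegree h0]
  rcases (by omega : f.totalDegree = 0 ∨ g.totalDegree = 0) with hf | hg
  · exact .inl ⟨_, totalDegree_eq_zero_iff_eq_C.1 hf⟩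
  · exact .inr ⟨_, totalDegree_eq_zero_iff_eq_C.1 hg⟩

lemma exists_smul_eq_of_dvd {K σ : Type*} [Field K] {f r : MvPolynomial σ K}
    (hf : f.IsHomogeneous 1) (hr : ¬ IsUnit r) (hrf : r ∣ f) : ∃ y : K, y • r = f := by
  rcases eq_or_ne f 0 with rfl | hf0
  · exact ⟨0, zero_smul _ _⟩
  obtain ⟨g, rfl⟩ := hrf
  rcases exists_eq_C_of_isHomogeneous_mul hf hf0 with ⟨y, rfl⟩ | ⟨y, rfl⟩
  · exact absurd ((C_ne_zero.1 (left_ne_zero_of_mul hf0)).isUnit.map C) hr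
  · exact ⟨y, by rw [smul_eq_C_mul, mul_comm]⟩

section LinearForm

variable {R ι : Type*} [CommRing R] [Fintype ι]

/-- The linear form `∑ j, a j * X j` with coefficient vector `a`. -/
def linearForm : (ι → R) →ₗ[R] MvPolynomial ι R :=
  Fintype.linearCombination R X

lemma linearForm_apply (a : ι → R) : linearForm a = ∑ j, C (a j) * X j := by
  simp only [linearForm, Fintype.linearCombination_apply, smul_eq_C_mul]

lemma linearForm_isHomogeneous (a : ι → R) : (linearForm a).IsHomogeneous 1 := by
  rw [linearForm_apply]
  exact IsHomogeneous.sum _ _ _ fun _ _ => isHomogeneous_C_mul_X _ _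

lemma coeff_linearForm (a : ι → R) (j : ι) : coeff (Finsupp.single j 1) (linearForm a) = a j := by
  classical
  simp [linearForm_apply, coeff_sum, coeff_C_mul, coeff_X, Finsupp.single_left_inj]

lemma linearForm_injective : Function.Injective (linearForm : (ι → R) → MvPolynomial ι R) := by
  intro a c h
  funext j
  rw [← coeff_linearForm a, h, coeff_linearForm]

lemma linearForm_eq_zero_iff {a : ι → R} : linearForm a = 0 ↔ a = 0 :=
  map_eq_zero_iff _ linearForm_injective

lemma exists_eq_linearForm {f : MvPolynomial ι R} (hf : f.IsHomogeneous 1) :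
    ∃ a, f = linearForm a := by
  refine ⟨fun j => coeff (Finsupp.single j 1) f, ?_⟩
  ext m
  by_cases hm : m.degree = 1
  · obtain ⟨j, rfl⟩ : m ∈ Set.range fun j : ι => Finsupp.single j 1 := by
      rwa [Finsupp.range_single_one]
    rw [coeff_linearForm]
  · rw [hf.coeff_eq_zero hm, (linearForm_isHomogeneous _).coeff_eq_zero hm]

lemma C_dvd_linearForm_iff {r : R} {a : ι → R} : C r ∣ linearForm a ↔ ∀ j, r ∣ a j := by
  refine ⟨fun h j => ?_, fun h => ?_⟩
  · rw [← coeff_linearForm a j]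
    exact (C_dvd_iff_dvd_coeff _ _).1 h _
  · rw [linearForm_apply]
    exact Finset.dvd_sum fun j _ => (map_dvd C (h j)).mul_right _

lemma map_linearForm {S : Type*} [CommRing S] (φ : R →+* S) (a : ι → R) :
    map φ (linearForm a) = linearForm (φ ∘ a) := by
  simp [linearForm_apply]

lemma aeval_linearForm {A : Type*} [CommRing A] [Algebra R A] (v : ι → A) (a : ι → R) :
    aeval v (linearForm a) = ∑ j, a j • v j := by
  simp [linearForm, Fintype.linearCombination_apply]

lemma irreducible_linearForm [IsDomain R] {a : ι → R} (ha : IsPrimitiveFamily a) :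
    Irreducible (linearForm a) := by
  have ha0 : linearForm a ≠ 0 := linearForm_eq_zero_iff.not.2 ha.ne_zero
  refine irreducible_of_totalDegree_eq_one ((linearForm_isHomogeneous a).totalDegree ha0) ?_
  refine fun r hr => ha r fun j => ?_
  rw [← coeff_linearForm a j]
  exact hr _

/-- A common divisor is a constant, or both forms are constant multiples of it and all minors
vanish. -/
lemma isRelPrime_linearForm [IsDomain R] {a c : ι → R} (hprim : IsPrimitiveFamily (Sum.elim a c))
    (hminor : minor a c ≠ 0) : IsRelPrime (linearForm a) (linearForm c) := by
  have ha0 := left_ne_zero_of_minor_ne_zero hminor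
  have hc0 := right_ne_zero_of_minor_ne_zero hminor
  have isUnit_C (r : R) (ha : C r ∣ linearForm a) (hc : C r ∣ linearForm c) :
      IsUnit (C r : MvPolynomial ι R) :=
    (hprim r (Sum.forall.2 ⟨C_dvd_linearForm_iff.1 ha, C_dvd_linearForm_iff.1 hc⟩)).map C
  intro f hfa hfc
  obtain ⟨g, hg⟩ := hfa
  obtain ⟨h, hh⟩ := hfc
  rcases exists_eq_C_of_isHomogeneous_mul (hg ▸ linearForm_isHomogeneous a)
    (hg ▸ linearForm_eq_zero_iff.not.2 ha0) with ⟨r, rfl⟩ | ⟨s, rfl⟩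
  · exact isUnit_C r ⟨g, hg⟩ ⟨h, hh⟩
  rcases exists_eq_C_of_isHomogeneous_mul (hh ▸ linearForm_isHomogeneous c)
    (hh ▸ linearForm_eq_zero_iff.not.2 hc0) with ⟨r, rfl⟩ | ⟨t, rfl⟩
  · exact isUnit_C r ⟨_, hg⟩ ⟨h, hh⟩
  have hs : s ≠ 0 := by
    rintro rfl
    exact ha0 (linearForm_eq_zero_iff.1 (by simp [hg]))
  have hprop : t • a = s • c := linearForm_injective <| by
    rw [map_smul, map_smul, smul_eq_C_mul, smul_eq_C_mul, hg, hh]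
    ring
  refine absurd (funext fun p => mul_left_cancel₀ hs ?_) hminor
  have h₁ := congrFun hprop p.1
  have h₂ := congrFun hprop p.2
  simp only [Pi.smul_apply, smul_eq_mul] at h₁ h₂
  simp only [minor, Pi.zero_apply]
  linear_combination a p.2 * h₁ - a p.1 * h₂

end LinearForm

section Elimination

variable {R ι : Type*} [CommRing R] [Fintype ι] [DecidableEq ι] {a : ι → R} {i : ι}

/-- The substitution that solves `linearForm a = 0` for the variable `X i`. It is meaningful when
`a i` is a unit; `Ring.inverse` is `0` otherwise. -/
def eliminate (a : ι → R) (i : ι) : MvPolynomial ι R →ₐ[R] MvPolynomial ι R :=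
  aeval fun j => X j - if j = i then C (Ring.inverse (a i)) * linearForm a else 0

lemma eliminate_linearForm (a c : ι → R) (i : ι) :
    eliminate a i (linearForm c) = linearForm (c - (c i * Ring.inverse (a i)) • a) := by
  rw [eliminate, aeval_linearForm, map_sub, map_smul, linearForm_apply c]
  simp [smul_sub, Finset.sum_sub_distrib, smul_eq_C_mul, mul_assoc]

lemma isReductionMod_eliminate (hi : IsUnit (a i)) :
    IsReductionMod (eliminate a i : MvPolynomial ι R →+* MvPolynomial ι R) (linearForm a) where
  map_self := by
    rw [RingHom.coe_coe, eliminate_linearForm, Ring.mul_inverse_cancel _ hi, one_smul, sub_self,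
      map_zero]
  dvd_sub_map := by
    have heq : (Ideal.Quotient.mkₐ R (Ideal.span {linearForm a})).comp (eliminate a i) =
        Ideal.Quotient.mkₐ R (Ideal.span {linearForm a}) := by
      refine algHom_ext fun j => (Ideal.Quotient.mk_eq_mk_iff_sub_mem _ _).2 ?_
      rw [RingHom.coe_coe, eliminate, aeval_X, sub_sub_cancel_left, neg_mem_iff,
        Ideal.mem_span_singleton]
      split_ifs
      exacts [dvd_mul_left _ _, dvd_zero _]
    intro f
    rw [← Ideal.mem_span_singleton, ← Ideal.Quotient.mk_eq_mk_iff_sub_mem]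
    exact (DFunLike.congr_fun heq f).symm

end Elimination

lemma isPrime_span_linearForm_pair_of_isUnit {R ι : Type*} [CommRing R] [IsDomain R]
    [UniqueFactorizationMonoid R] [Fintype ι] {a c : ι → R} {i : ι} (hi : IsUnit (a i))
    (h : IsPrimitiveFamily (minor a c)) : (Ideal.span {linearForm a, linearForm c}).IsPrime := by
  classical
  refine (isReductionMod_eliminate hi).isPrime_span_pair (Irreducible.prime ?_)
  rw [RingHom.coe_coe, eliminate_linearForm]
  set k := c i * Ring.inverse (a i)
  refine irreducible_linearForm fun r hr => h r fun p => ?_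
  rw [← minor_sub_smul_right a c k]
  exact dvd_sub ((hr _).mul_left _) ((hr _).mul_left _)

attribute [local instance] algebraMvPolynomial in
lemma comap_map_of_isLocalizationAway {R S ι : Type*} [CommRing R] [CommRing S] [Algebra R S]
    (x : R) [IsLocalization.Away x S] {I : Ideal (MvPolynomial ι R)}
    (hx : ∀ f, C x * f ∈ I → f ∈ I) :
    (I.map (map (algebraMap R S))).comap (map (algebraMap R S)) = I := by
  refine le_antisymm (fun f hf => ?_) Ideal.le_comap_map
  obtain ⟨_, ⟨_, ⟨k, rfl⟩, rfl⟩, hk⟩ :=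
    (IsLocalization.algebraMap_mem_map_algebraMap_iff
      ((Submonoid.powers x).map (C : R →+* MvPolynomial ι R)) (MvPolynomial ι S) I f).1 hf
  induction k with
  | zero => simpa using hk
  | succ k ih => exact ih (hx _ (by simpa [pow_succ', mul_assoc] using hk))

lemma isPrime_span_linearForm_pair {R ι : Type*} [CommRing R] [IsDomain R]
    [UniqueFactorizationMonoid R] [Fintype ι] {a c : ι → R} {i : ι} (hi : a i ≠ 0)
    (h : IsPrimitiveFamily (minor a c))
    (hreg : ∀ f, C (a i) * f ∈ Ideal.span {linearForm a, linearForm c} →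
      f ∈ Ideal.span {linearForm a, linearForm c}) :
    (Ideal.span {linearForm a, linearForm c}).IsPrime := by
  let S := Localization.Away (a i)
  have := IsLocalization.Away.isDomain S hi
  have hprime : (Ideal.span {linearForm (algebraMap R S ∘ a),
      linearForm (algebraMap R S ∘ c)}).IsPrime := by
    refine isPrime_span_linearForm_pair_of_isUnit (i := i)
      (IsLocalization.Away.algebraMap_isUnit (a i)) ?_
    rw [← funext (map_minor _ a c)]
    exact h.of_isLocalization (Submonoid.powers (a i)) S
  rw [← comap_map_of_isLocalizationAway (S := S) (a i) hreg, Ideal.map_span, Set.image_pair,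
    map_linearForm, map_linearForm]
  exact Ideal.comap_isPrime _ _

section Pencil

variable {K σ ι κ : Type*} [Field K]

lemma exists_isReductionMod [Finite σ] {τ : MvPolynomial σ K} (hτ : τ.IsHomogeneous 1)
    (hτ0 : τ ≠ 0) : ∃ π : MvPolynomial σ K →+* MvPolynomial σ K, IsReductionMod π τ ∧
      ∀ f, f.IsHomogeneous 1 → (π f).IsHomogeneous 1 := by
  classical
  have := Fintype.ofFinite σ
  obtain ⟨e, rfl⟩ := exists_eq_linearForm hτ
  obtain ⟨i, hi⟩ := Function.ne_iff.1 (linearForm_eq_zero_iff.not.1 hτ0)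
  refine ⟨_, isReductionMod_eliminate (Ne.isUnit hi), fun f hf => ?_⟩
  obtain ⟨c, rfl⟩ := exists_eq_linearForm hf
  rw [RingHom.coe_coe, eliminate_linearForm]
  exact linearForm_isHomogeneous _

/-- A common divisor of the reductions modulo `τ` spans, together with `τ`, all the forms. -/
lemma isPrimitiveFamily_comp_of_notMem_span_pair {f : κ → MvPolynomial σ K}
    (hf : ∀ k, (f k).IsHomogeneous 1) (hspan : ∀ s τ, ∃ k, f k ∉ Submodule.span K {s, τ})
    {π : MvPolynomial σ K →+* MvPolynomial σ K} {τ : MvPolynomial σ K} (hτ : ¬ IsUnit τ)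
    (hπ : IsReductionMod π τ) (hπf : ∀ g, g.IsHomogeneous 1 → (π g).IsHomogeneous 1) :
    IsPrimitiveFamily (π ∘ f) := by
  intro r hr
  by_contra hru
  obtain ⟨k, hk⟩ := hspan r τ
  obtain ⟨y, hy⟩ := exists_smul_eq_of_dvd (hπf _ (hf k)) hru (hr k)
  obtain ⟨z, hz⟩ := exists_smul_eq_of_dvd ((hf k).sub (hπf _ (hf k))) hτ
    (hπ.dvd_sub_map (f k))
  exact hk (Submodule.mem_span_pair.2 ⟨y, z, by rw [hy, hz, add_sub_cancel]⟩)

theorem isPrime_span_linearForm_pair_of_notMem_span_pair [Finite σ] [Fintype ι]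
    {a c : ι → MvPolynomial σ K} (ha : ∀ j, (a j).IsHomogeneous 1)
    (hc : ∀ j, (c j).IsHomogeneous 1) (hminor : IsPrimitiveFamily (minor a c))
    (hspan : ∀ s τ, ∃ k, Sum.elim a c k ∉ Submodule.span K {s, τ}) :
    (Ideal.span {linearForm a, linearForm c}).IsPrime := by
  obtain ⟨i, hi⟩ := Function.ne_iff.1 (left_ne_zero_of_minor_ne_zero hminor.ne_zero)
  have hτ := not_isUnit_of_isHomogeneous (ha i) one_ne_zero
  obtain ⟨π, hπ, hπ1⟩ := exists_isReductionMod (ha i) hi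
  have hprim : IsPrimitiveFamily (Sum.elim (π ∘ a) (π ∘ c)) := by
    rw [← Sum.comp_elim]
    exact isPrimitiveFamily_comp_of_notMem_span_pair (Sum.forall.2 ⟨ha, hc⟩) hspan hτ hπ hπ1
  have hminor0 : minor (π ∘ a) (π ∘ c) ≠ 0 := fun h =>
    hτ (hminor _ fun p => hπ.dvd_of_map_eq_zero (by rw [map_minor, h, Pi.zero_apply]))
  refine isPrime_span_linearForm_pair hi hminor fun f hf => ?_
  refine (hπ.mvPolynomial_map ι).mem_span_pair_of_mul_mem (C_ne_zero.2 hi) ?_ ?_ hf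
  · rw [map_linearForm, map_linearForm]
    exact isRelPrime_linearForm hprim hminor0
  · rw [map_linearForm, Ne, linearForm_eq_zero_iff]
    exact left_ne_zero_of_minor_ne_zero hminor0

end Pencil

lemma exists_smul_of_linearForm_mul_eq {K ι : Type*} [Field K] [Fintype ι] {x x' y y' : ι → K}
    (h : linearForm x * linearForm y' = linearForm x' * linearForm y) :
    (∃ (α β : K) (z : ι → K), x = α • z ∧ x' = β • z) ∨
      ∃ (α β : K) (z w : ι → K), x = α • z ∧ x' = α • w ∧ y = β • z ∧ y' = β • w := by
  rcases eq_or_ne x 0 with rfl | hx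
  · rw [map_zero, zero_mul, eq_comm, mul_eq_zero] at h
    simp only [linearForm_eq_zero_iff] at h
    rcases h with rfl | rfl
    · exact .inr ⟨0, 1, y, y', by simp⟩
    · exact .inl ⟨0, 1, x', by simp⟩
  have hprime : Prime (linearForm x) :=
    (irreducible_linearForm (isPrimitiveFamily_of_ne_zero hx)).prime
  have eq_smul_of_dvd {z : ι → K} (hz : linearForm x ∣ linearForm z) : ∃ k : K, z = k • x := by
    obtain ⟨k, hk⟩ := exists_smul_eq_of_dvd (linearForm_isHomogeneous z) hprime.not_isUnit hz
    exact ⟨k, linearForm_injective (by rw [map_smul, hk])⟩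
  rcases hprime.dvd_or_dvd ⟨_, h.symm⟩ with hx' | hy
  · obtain ⟨k, rfl⟩ := eq_smul_of_dvd hx'
    exact .inl ⟨1, k, x, by simp⟩
  · obtain ⟨k, rfl⟩ := eq_smul_of_dvd hy
    have hy' : y' = k • x' := linearForm_injective <| mul_left_cancel₀ hprime.ne_zero <| by
      rw [h, map_smul, map_smul, mul_smul_comm, mul_smul_comm, mul_comm]
    exact .inr ⟨1, k, x, x', by simp [hy']⟩

lemma eval_smul_of_isHomogeneous {R σ : Type*} [CommRing R] {q : MvPolynomial σ R} {k : ℕ}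
    (hq : q.IsHomogeneous k) (r : R) (v : σ → R) : eval (r • v) q = r ^ k * eval v q := by
  simp only [eval_eq, Finset.mul_sum]
  refine Finset.sum_congr rfl fun p hp => ?_
  have hdeg : ∑ i ∈ p.support, p i = k := by
    by_contra h
    exact mem_support_iff.1 hp (hq.coeff_eq_zero h)
  simp only [Pi.smul_apply, smul_eq_mul, mul_pow, Finset.prod_mul_distrib,
    Finset.prod_pow_eq_pow_sum, hdeg]
  ring

section Syzygies

variable {K : Type*} [Field K] {m n : ℕ} {u : Fin m → MvPolynomial (Fin n) K}

lemma mem_syz {a : Fin m → MvPolynomial (Fin n) K} : a ∈ syz u ↔ ∑ j, a j * u j = 0 := by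
  simp [syz, Fintype.linearCombination_apply]

lemma dvd_repr_of_dvd {κ : Type*} (b : Module.Basis κ (MvPolynomial (Fin n) K) (syz u))
    {r : MvPolynomial (Fin n) K} {v : syz u} (hv : ∀ j, r ∣ v.1 j) (p : κ) : r ∣ b.repr v p := by
  choose w hw using hv
  have hvw : v.1 = r • w := funext hw
  rcases eq_or_ne r 0 with rfl | hr
  · obtain rfl : v = 0 := Subtype.ext (by rw [hvw, zero_smul]; rfl)
    simp
  have hws : w ∈ syz u := by
    refine mem_syz.2 (mul_left_cancel₀ hr ?_)
    rw [mul_zero, Finset.mul_sum, ← mem_syz.1 v.2]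
    exact Finset.sum_congr rfl fun j _ => by rw [hvw, Pi.smul_apply, smul_eq_mul, mul_assoc]
  obtain rfl : v = r • ⟨w, hws⟩ := Subtype.ext hvw
  rw [map_smul]
  exact dvd_mul_right _ _

lemma isPrimitiveFamily_minor_basis {κ : Type*}
    (b : Module.Basis κ (MvPolynomial (Fin n) K) (syz u)) {k l : κ} (hkl : k ≠ l) :
    IsPrimitiveFamily (minor (b k).1 (b l).1) := by
  intro r hr
  have dvd_entry (j : Fin m) : r ∣ (b k).1 j := by
    have hrow : r ∣ b.repr ((b k).1 j • b l - (b l).1 j • b k) l :=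
      dvd_repr_of_dvd b (fun i => by simpa [minor, mul_comm] using hr (j, i)) l
    simpa [hkl] using hrow
  have := dvd_repr_of_dvd b dvd_entry k
  rw [b.repr_self, Finsupp.single_eq_same] at this
  exact isUnit_of_dvd_one this

lemma eq_zero_of_aeval_eq_zero {δ k : ℕ} (hS : IsHypersurfaceOfDegree (paramVariety u) δ)
    {q : MvPolynomial (Fin m) K} (hq : q.IsHomogeneous k) (hk : k < δ) (hqu : aeval u q = 0) :
    q = 0 := by
  obtain ⟨E, -, -, hE, rfl⟩ := hS
  have eval_image (t : Fin n → K) : eval (fun i => eval t (u i)) q = 0 := by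
    rw [← map_zero (aeval t : MvPolynomial (Fin n) K →ₐ[K] K), ← hqu, comp_aeval_apply]
    simp [aeval_eq_eval]
  have hmem : q ∈ vanishingIdeal K (affineCone (paramVariety u)) := by
    rw [mem_vanishingIdeal_iff]
    rintro v ⟨hv, hP⟩
    refine hP k q hq ?_ v ⟨hv, rfl⟩
    rintro w ⟨_, t, -, _, hwt⟩
    obtain ⟨r, rfl⟩ := (Projectivization.mk_eq_mk_iff' ..).1 hwt
    rw [eval_smul_of_isHomogeneous hq, eval_image, mul_zero]
  rw [hE, Ideal.mem_span_singleton] at hmem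
  by_contra h0
  have hdeg := totalDegree_le_of_dvd_of_isDomain hmem h0
  rw [hq.totalDegree h0] at hdeg
  omega

/-- Evaluated at `u`, the matrix of linear forms with rows `(x, x')` and `(y, y')` kills `(s, τ)`,
so its determinant is a quadric containing the parametrized variety. -/
lemma linearForm_mul_eq_of_mem_syz {a c : Fin m → MvPolynomial (Fin n) K} {δ : ℕ}
    (ha : a ∈ syz u) (hc : c ∈ syz u) (ha0 : a ≠ 0)
    (hS : IsHypersurfaceOfDegree (paramVariety u) δ) (hδ : 3 ≤ δ) {s τ : MvPolynomial (Fin n) K}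
    {x x' y y' : Fin m → K} (hax : ∀ j, x j • s + x' j • τ = a j)
    (hcy : ∀ j, y j • s + y' j • τ = c j) :
    linearForm x * linearForm y' = linearForm x' * linearForm y := by
  have aeval_eq_zero {z z' : Fin m → K} {e : Fin m → MvPolynomial (Fin n) K} (he : e ∈ syz u)
      (hez : ∀ j, z j • s + z' j • τ = e j) :
      s * aeval u (linearForm z) + τ * aeval u (linearForm z') = 0 := by
    rw [← mem_syz.1 he]
    simp only [← hez, aeval_linearForm, Finset.mul_sum, ← Finset.sum_add_distrib, add_mul,
      smul_mul_assoc, mul_smul_comm]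
  have hsa := aeval_eq_zero ha hax
  have hsc := aeval_eq_zero hc hcy
  refine sub_eq_zero.1 (eq_zero_of_aeval_eq_zero hS
    (((linearForm_isHomogeneous x).mul (linearForm_isHomogeneous y')).sub
      ((linearForm_isHomogeneous x').mul (linearForm_isHomogeneous y))) (by omega) ?_)
  rw [map_sub, map_mul, map_mul]
  by_cases hs : s = 0
  · have hτ : τ ≠ 0 := by
      rintro rfl
      exact ha0 (funext fun j => by rw [← hax, hs, smul_zero, smul_zero, add_zero, Pi.zero_apply])
    refine mul_left_cancel₀ hτ ?_
    linear_combination aeval u (linearForm x) * hsc - aeval u (linearForm y) * hsa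
  · refine mul_left_cancel₀ hs ?_
    linear_combination aeval u (linearForm y') * hsa - aeval u (linearForm x') * hsc

lemma exists_entry_notMem_span_pair {a c : Fin m → MvPolynomial (Fin n) K} {δ : ℕ}
    (ha : a ∈ syz u) (hc : c ∈ syz u) (ha1 : ∀ j, (a j).IsHomogeneous 1)
    (hminor : IsPrimitiveFamily (minor a c)) (hS : IsHypersurfaceOfDegree (paramVariety u) δ)
    (hδ : 3 ≤ δ) (s τ : MvPolynomial (Fin n) K) :
    ∃ k, Sum.elim a c k ∉ Submodule.span K {s, τ} := by
  by_contra! hspan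
  simp only [Submodule.mem_span_pair, Sum.forall, Sum.elim_inl, Sum.elim_inr] at hspan
  obtain ⟨hax, hcy⟩ := hspan
  choose x x' hax using hax
  choose y y' hcy using hcy
  have ha0 := left_ne_zero_of_minor_ne_zero hminor.ne_zero
  rcases exists_smul_of_linearForm_mul_eq (linearForm_mul_eq_of_mem_syz ha hc ha0 hS hδ hax hcy)
    with ⟨α, β, z, rfl, rfl⟩ | ⟨α, β, z, w, rfl, rfl, rfl, rfl⟩
  · -- Every entry of `a` is a multiple of `α • s + β • τ`, which therefore divides all the minors.
    set l := α • s + β • τ with hl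
    have haz (j : Fin m) : a j = C (z j) * l := by
      simp only [← hax, hl, Pi.smul_apply, smul_eq_mul, smul_eq_C_mul, C_mul]
      ring
    have hlu : IsUnit l := hminor l (dvd_minor fun j => ⟨_, (haz j).trans (mul_comm _ _)⟩)
    obtain ⟨i, hi⟩ := Function.ne_iff.1 ha0
    have hzi : z i ≠ 0 := fun h => hi (by rw [haz, h, C_0, zero_mul, Pi.zero_apply])
    refine not_isUnit_of_isHomogeneous (ha1 i) one_ne_zero ?_
    rw [haz]
    exact (hzi.isUnit.map C).mul hlu
  · refine hminor.ne_zero (funext fun p => ?_)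
    simp only [minor, ← hax, ← hcy, Pi.smul_apply, Pi.zero_apply, smul_eq_mul, smul_eq_C_mul, C_mul]
    ring

/-- Polynomials in the parameters and the coordinates, read as polynomials in the coordinates
whose coefficients are polynomials in the parameters. -/
def coordEquiv (K : Type*) [Field K] (m n : ℕ) :
    MvPolynomial (Fin n ⊕ Fin m) K ≃ₐ[K] MvPolynomial (Fin m) (MvPolynomial (Fin n) K) :=
  (renameEquiv K (Equiv.sumComm (Fin n) (Fin m))).trans (sumAlgEquiv K (Fin m) (Fin n))

lemma coordEquiv_rename_inl (f : MvPolynomial (Fin n) K) :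
    coordEquiv K m n (rename Sum.inl f) = C f := by
  rw [coordEquiv, AlgEquiv.trans_apply, renameEquiv_apply, rename_rename]
  exact DFunLike.congr_fun (sumAlgEquiv_comp_rename_inr K (Fin m) (Fin n)) f

lemma coordEquiv_X_inr (j : Fin m) : coordEquiv K m n (X (Sum.inr j)) = X j := by
  simp [coordEquiv]

lemma coordEquiv_movingPlane (a : Fin m → MvPolynomial (Fin n) K) :
    coordEquiv K m n (movingPlane a) = linearForm a := by
  simp only [movingPlane, linearForm_apply, map_sum, map_mul, coordEquiv_rename_inl,
    coordEquiv_X_inr]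

lemma span_movingPlane_pair_eq_comap (a c : Fin m → MvPolynomial (Fin n) K) :
    Ideal.span {movingPlane a, movingPlane c} =
      (Ideal.span {linearForm a, linearForm c}).comap (coordEquiv K m n) := by
  rw [← coordEquiv_movingPlane a, ← coordEquiv_movingPlane c,
    ← Set.image_pair (coordEquiv K m n), ← Ideal.map_span]
  exact (Ideal.comap_map_of_bijective _ (coordEquiv K m n).bijective).symm

end Syzygies

end MovingPlanes

end

theorem proposition4p4_general {K : Type*} [Field K] {m n : ℕ}
    {u a c : Fin m → MvPolynomial (Fin n) K}
    (ha : a ∈ MovingPlanes.syz u) (hc : c ∈ MovingPlanes.syz u)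
    (ha1 : ∀ j, (a j).IsHomogeneous 1) (hc1 : ∀ j, (c j).IsHomogeneous 1)
    (hminor : MovingPlanes.IsPrimitiveFamily (MovingPlanes.minor a c))
    {δ : ℕ} (hS : MovingPlanes.IsHypersurfaceOfDegree (MovingPlanes.paramVariety u) δ)
    (hδ : 3 ≤ δ) :
    (Ideal.span {MovingPlanes.movingPlane a, MovingPlanes.movingPlane c}).IsPrime := by
  have := MovingPlanes.isPrime_span_linearForm_pair_of_notMem_span_pair ha1 hc1 hminor
    (MovingPlanes.exists_entry_notMem_span_pair ha hc ha1 hminor hS hδ)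
  rw [MovingPlanes.span_movingPlane_pair_eq_comap]
  exact Ideal.comap_isPrime _ _

theorem proposition4p4 {K : Type*} [Field K] [IsAlgClosed K]
    (d : ℕ) (hd : 2 < d)
    (u : Fin 4 → MvPolynomial (Fin 3) K)
    (hu0 : ∀ i, u i ≠ 0)
    (huhom : ∀ i, (u i).IsHomogeneous d)
    (hgcd : ∀ q : MvPolynomial (Fin 3) K, (∀ i, q ∣ u i) → IsUnit q)
    (hsat : MovingPlanes.IsSaturated (Ideal.span (Set.range u)))
    (b : Module.Basis (Fin 3) (MvPolynomial (Fin 3) K) (MovingPlanes.syz u))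
    (hb0 : ∀ j, ((b 0 : Fin 4 → MvPolynomial (Fin 3) K) j).IsHomogeneous 1)
    (hb1 : ∀ j, ((b 1 : Fin 4 → MvPolynomial (Fin 3) K) j).IsHomogeneous 1)
    (hb2 : ∀ j, ((b 2 : Fin 4 → MvPolynomial (Fin 3) K) j).IsHomogeneous (d - 2))
    (δ : ℕ) (hS : MovingPlanes.IsHypersurfaceOfDegree (MovingPlanes.paramVariety u) δ)
    (hδ : 3 ≤ δ) :
    (Ideal.span {MovingPlanes.movingPlane (b 0 : Fin 4 → MvPolynomial (Fin 3) K),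
      MovingPlanes.movingPlane (b 1 : Fin 4 → MvPolynomial (Fin 3) K)}).IsPrime :=
  proposition4p4_general (b 0).2 (b 1).2 hb0 hb1
    (MovingPlanes.isPrimitiveFamily_minor_basis b (by decide)) hS hδ
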